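/- All graphs are finite and simple. A frame is the boundary of a non-degenerate axis-aligned rectangle $[a,b]\times[c,d]$ ($a<b$, $c<d$) in $\mathbb{R}^2$. The intersection graph of a set of frames has the frames as its vertices, two distinct frames being adjacent if and only if they have a common point. A frame $A$ is entirely inside a frame $B$ if $A$ is contained in the open area enclosed by $B$. If $A$ is the boundary of $[a,b]\times[c,d]$ and $B$ is the boundary of $[a',b']\times[c',d']$, then $A$ enters $B$ if $a'<a<b'<b$ and $c'<c<d<d'$. A set of frames is restricted if: 1. no three frames are mutually intersecting; 2. no corner of a frame is a point of another frame; 3. the left side of a frame does not intersect any other frame; 4. if the right side of a frame intersects a second frame, then this right side intersects both the top and the bottom side of the second frame; 5. if two distinct frames intersect, then no frame of the set is contained in the intersection of the two closed regions (full rectangles) that they bound. A restricted set of frames is strict if, for any frames $A$, $B$ of the set such that $A$ is entirely inside $B$, every frame $C$ of the set that intersects both $A$ and $B$ enters both $A$ and $B$. A strict frame graph is a graph isomorphic to the intersection graph of a strict set of frames. For a graph $G$ and a set $\mathcal S$ of stable sets of $G$, define a pair $(G',\mathcal S')$ as follows. The graph $G'$ consists of a copy of $G$, a further copy $G_S$ of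 $G$ for every $S\in\mathcal S$ (with no edges between different copies), and, for every $S\in\mathcal S$ and every $Q\in\mathcal S_S$, where $\mathcal S_S$ is the copy of $\mathcal S$ in $G_S$, a new vertex $v_{S,Q}$ whose neighbors are exactly the vertices of $Q$. The set $\mathcal S'$ consists of all sets $S\cup Q$ and $S\cup\{v_{S,Q}\}$ with $S\in\mathcal S$ (in the first copy of $G$) and $Q\in\mathcal S_S$. The Burling sequence $(G_k)_{k\ge 1}$ is obtained by iterating this operation, starting with $G_1=K_1$ and $\mathcal S_1=\{V(G_1)\}$. A Burling graph is a graph isomorphic to an induced subgraph of some $G_k$. **Theorem.** The class of strict frame graphs is equal to the class of Burling graphs: a finite graph is a strict frame graph if and only if it is a Burling graph. -/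

import Mathlib

/-! ### Frames -/

/-- A frame, given by the axis-aligned (non-degenerate) rectangle
`[xmin, xmax] × [ymin, ymax]` of which it is the boundary. -/
@[ext]
structure Frame where
  xmin : ℝ
  xmax : ℝ
  ymin : ℝ
  ymax : ℝ
  hx : xmin < xmax
  hy : ymin < ymax

namespace Frame

def leftSide (A : Frame) : Set (ℝ × ℝ) := {A.xmin} ×ˢ Set.Icc A.ymin A.ymax

def rightSide (A : Frame) : Set (ℝ × ℝ) := {A.xmax} ×ˢ Set.Icc A.ymin A.ymax

def bottomSide (A : Frame) : Set (ℝ × ℝ) := Set.Icc A.xmin A.xmax ×ˢ {A.ymin}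

def topSide (A : Frame) : Set (ℝ × ℝ) := Set.Icc A.xmin A.xmax ×ˢ {A.ymax}

/-- The four corners of a frame. -/
def corners (A : Frame) : Set (ℝ × ℝ) :=
  {(A.xmin, A.ymin), (A.xmin, A.ymax), (A.xmax, A.ymin), (A.xmax, A.ymax)}

/-- The point set of a frame (the boundary of the rectangle). -/
def carrier (A : Frame) : Set (ℝ × ℝ) :=
  A.leftSide ∪ A.rightSide ∪ A.bottomSide ∪ A.topSide

/-- The (closed) region bounded by a frame, i.e. the full rectangle. -/
def region (A : Frame) : Set (ℝ × ℝ) :=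
  Set.Icc A.xmin A.xmax ×ˢ Set.Icc A.ymin A.ymax

/-- The open area enclosed by a frame. -/
def enclosed (A : Frame) : Set (ℝ × ℝ) :=
  Set.Ioo A.xmin A.xmax ×ˢ Set.Ioo A.ymin A.ymax

/-- The point set of a frame is the topological boundary of the rectangle. -/
theorem carrier_eq_frontier (A : Frame) : A.carrier = frontier A.region := by
  have hx := A.hx
  have hy := A.hy
  rw [region, frontier_prod_eq, frontier_Icc hy.le, frontier_Icc hx.le, closure_Icc, closure_Icc]
  ext ⟨x, y⟩
  simp only [carrier, leftSide, rightSide, bottomSide, topSide, Set.mem_union, Set.mem_prod,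
    Set.mem_singleton_iff, Set.mem_insert_iff]
  tauto

/-- Two frames intersect if they share a point (of their boundaries). -/
def Meets (A B : Frame) : Prop := (A.carrier ∩ B.carrier).Nonempty

/-- `A` is entirely inside `B`. -/
def Inside (A B : Frame) : Prop := A.carrier ⊆ B.enclosed

/-- `A` enters `B`: the left side of `A` lies in the area enclosed by `B`, and `A` sticks out of
`B` through the right side of `B`, which crosses the top and the bottom of `A`. -/
def Enters (A B : Frame) : Prop :=
  B.xmin < A.xmin ∧ A.xmin < B.xmax ∧ B.xmax < A.xmax ∧ B.ymin < A.ymin ∧ A.ymax < B.ymax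

end Frame

/-- The intersection graph of a set of frames: its vertices are the frames of the set, and two
distinct frames are adjacent if and only if they intersect. -/
def frameIntersectionGraph (F : Set Frame) : SimpleGraph F where
  Adj A B := A ≠ B ∧ Frame.Meets A B
  symm := ⟨fun A B h => ⟨h.1.symm, by
    have h2 := h.2
    rwa [Frame.Meets, Set.inter_comm] at h2⟩⟩
  loopless := ⟨fun _ h => h.1 rfl⟩

/-- Restricted sets of frames. -/
structure IsRestricted (F : Set Frame) : Prop where
  /-- no three frames are mutually intersecting -/
  triangleFree : (frameIntersectionGraph F).CliqueFree 3
  /-- no corner of a frame is a point of another frame -/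
  corners : ∀ A ∈ F, ∀ B ∈ F, A ≠ B → Disjoint A.corners B.carrier
  /-- the left side of a frame does not intersect any other frame -/
  left : ∀ A ∈ F, ∀ B ∈ F, A ≠ B → Disjoint A.leftSide B.carrier
  /-- if the right side of a frame intersects a second frame, then this right side intersects both
  the top and the bottom of the second frame -/
  right : ∀ A ∈ F, ∀ B ∈ F, A ≠ B → (A.rightSide ∩ B.carrier).Nonempty →
    (A.rightSide ∩ B.topSide).Nonempty ∧ (A.rightSide ∩ B.bottomSide).Nonempty
  /-- if two frames intersect, then no frame is contained in the intersection of the regions that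
  they bound -/
  inter : ∀ A ∈ F, ∀ B ∈ F, A ≠ B → A.Meets B → ∀ C ∈ F, ¬ C.carrier ⊆ A.region ∩ B.region

/-- Strict sets of frames: restricted sets in which every frame that intersects two nested frames
enters both of them. -/
structure IsStrict (F : Set Frame) : Prop extends IsRestricted F where
  strict : ∀ A ∈ F, ∀ B ∈ F, A.Inside B → ∀ C ∈ F, C.Meets A → C.Meets B →
    C.Enters A ∧ C.Enters B

/-- A strict frame graph is (up to isomorphism) the intersection graph of a strict set of
frames. -/
def IsStrictFrameGraph {V : Type*} (G : SimpleGraph V) : Prop :=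
  ∃ F : Set Frame, IsStrict F ∧ Nonempty (G ≃g frameIntersectionGraph F)

/-! ### Burling graphs -/

/-- A pair consisting of a graph and a set of stable sets of it. -/
structure StablePair where
  V : Type
  graph : SimpleGraph V
  sets : Set (Set V)
  stable : ∀ S ∈ sets, graph.IsIndepSet S

namespace StablePair

/-- The vertices of the next graph in the Burling construction. -/
inductive NextVertex (P : StablePair) : Type
  /-- the vertices of the copy of the graph -/
  | base (v : P.V) : NextVertex P
  /-- the vertices of the copy of the graph attached to the stable set `S` -/
  | copy (S : P.sets) (v : P.V) : NextVertex P
  /-- the new vertex attached to the stable set `S` and to the stable set `Q` in the copy of the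
  graph attached to `S` -/
  | new (S Q : P.sets) : NextVertex P

/-- Adjacency in the next graph: each copy keeps its edges, and the new vertex attached to `S`, `Q`
is adjacent exactly to the vertices of `Q` in the copy attached to `S`. -/
inductive NextAdj (P : StablePair) : NextVertex P → NextVertex P → Prop
  | base {v w : P.V} (h : P.graph.Adj v w) : NextAdj P (.base v) (.base w)
  | copy (S : P.sets) {v w : P.V} (h : P.graph.Adj v w) : NextAdj P (.copy S v) (.copy S w)
  | newCopy (S Q : P.sets) {v : P.V} (h : v ∈ Q.1) : NextAdj P (.new S Q) (.copy S v)
  | copyNew (S Q : P.sets) {v : P.V} (h : v ∈ Q.1) : NextAdj P (.copy S v) (.new S Q)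

/-- The graph of the next pair. -/
def nextGraph (P : StablePair) : SimpleGraph (NextVertex P) where
  Adj := NextAdj P
  symm := ⟨fun _ _ h => by
    cases h with
    | base h => exact .base h.symm
    | copy S h => exact .copy S h.symm
    | newCopy S Q h => exact .copyNew S Q h
    | copyNew S Q h => exact .newCopy S Q h⟩
  loopless := ⟨fun _ h => by
    cases h with
    | base h => exact P.graph.loopless.irrefl _ h
    | copy S h => exact P.graph.loopless.irrefl _ h⟩

/-- The stable sets of the next pair: all sets `S ∪ Q` and `S ∪ {v_{S,Q}}`, where `S` is a stable
set of the system in the first copy, and `Q` is one in the copy attached to `S`. -/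
def nextSets (P : StablePair) : Set (Set (NextVertex P)) :=
  {X | ∃ S Q : P.sets,
    X = NextVertex.base '' S.1 ∪ NextVertex.copy S '' Q.1 ∨
    X = NextVertex.base '' S.1 ∪ {NextVertex.new S Q}}

/-- One step of the Burling construction. -/
def next (P : StablePair) : StablePair where
  V := NextVertex P
  graph := P.nextGraph
  sets := P.nextSets
  stable := by
    rintro X ⟨⟨S, hS⟩, ⟨Q, hQ⟩, rfl | rfl⟩ x hx y hy hxy h
    · have h1 := P.stable S hS
      have h2 := P.stable Q hQ
      cases h with
      | base h => exact h1 (by simpa using hx) (by simpa using hy) h.ne h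
      | copy S' h =>
        simp only [Set.mem_union, Set.mem_image, reduceCtorEq, and_false, exists_false,
          NextVertex.copy.injEq, false_or] at hx hy
        obtain ⟨v, hv, -, rfl⟩ := hx
        obtain ⟨w, hw, -, rfl⟩ := hy
        exact h2 hv hw h.ne h
      | newCopy S' Q' h => simp at hx
      | copyNew S' Q' h => simp at hy
    · have h1 := P.stable S hS
      cases h with
      | base h => exact h1 (by simpa using hx) (by simpa using hy) h.ne h
      | copy S' h => simp at hx
      | newCopy S' Q' h => simp at hy
      | copyNew S' Q' h => simp at hx

end StablePair

/-- The Burling sequence, indexed from `0`: it starts with the one-vertex graph and the system that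
consists of its whole vertex set. -/
def burlingPair : ℕ → StablePair
  | 0 =>
    { V := Unit
      graph := ⊥
      sets := {Set.univ}
      stable := fun _ _ _ _ _ _ _ h => h }
  | k + 1 => (burlingPair k).next

/-- A Burling graph is (up to isomorphism) an induced subgraph of a graph of the Burling
sequence. -/
def IsBurlingGraph {V : Type*} (G : SimpleGraph V) : Prop :=
  ∃ (k : ℕ) (W : Set (burlingPair k).V), Nonempty (G ≃g (burlingPair k).graph.induce W)

/-! Both directions pass through `IsArrangement`, which describes a strict set by relative positions
alone: two distinct frames are nested, bound disjoint rectangles, or one enters the other; and when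
one frame enters another, no left side lies in both enclosed areas. Hence the frames around a given
left side form a chain under nesting (`IsArrangement.comparable`).

From frames to Burling graphs (`IsArrangement.exists_represents`): among the frames inside no other,
let x be the one whose left side is farthest right. No frame enters x, and nothing inside x is
adjacent to anything that is not. The frames that x enters are an innermost one and all those around
it. So if the frames other than x and not inside it embed in a Burling graph with every up-set of
nesting a trace of a stable set, then x can be a vertex v_{S,Q} with Q tracing its neighborhood. The
frames inside x go into a copy attached to a stable set with trace {x} (`Represents.glue`).

From Burling graphs to frames (`Realizes.next`): along with the frames, every stable set S carries a
root, a rectangle inside all frames of S, such that the strip extending it to the right misses all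
other frames. Distinct roots have disjoint vertical ranges. The copy attached to S is drawn inside
the root of S, and a new frame starting in the root of Q and running to the right enters exactly the
frames of Q. -/

namespace Frame

/-! ### Relative positions of two frames -/

/-- Coordinate form of `Frame.Inside`. -/
def Within (A B : Frame) : Prop :=
  B.xmin < A.xmin ∧ A.xmax < B.xmax ∧ B.ymin < A.ymin ∧ A.ymax < B.ymax

/-- The rectangles bounded by the two frames are disjoint. -/
def Apart (A B : Frame) : Prop :=
  A.xmax < B.xmin ∨ B.xmax < A.xmin ∨ A.ymax < B.ymin ∨ B.ymax < A.ymin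

/-- The left side of `A` lies in the area enclosed by `B`. -/
def StartsIn (A B : Frame) : Prop :=
  B.xmin < A.xmin ∧ A.xmin < B.xmax ∧ B.ymin < A.ymin ∧ A.ymax < B.ymax

theorem mem_carrier {A : Frame} {x y : ℝ} : (x, y) ∈ A.carrier ↔
    (A.xmin ≤ x ∧ x ≤ A.xmax ∧ A.ymin ≤ y ∧ y ≤ A.ymax) ∧
      (x = A.xmin ∨ x = A.xmax ∨ y = A.ymin ∨ y = A.ymax) := by
  have hx := A.hx
  have hy := A.hy
  simp only [carrier, leftSide, rightSide, bottomSide, topSide, Set.mem_union, Set.mem_prod,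
    Set.mem_singleton_iff, Set.mem_Icc]
  constructor
  · rintro (((⟨h, h1, h2⟩ | ⟨h, h1, h2⟩) | ⟨⟨h1, h2⟩, h⟩) | ⟨⟨h1, h2⟩, h⟩) <;> grind
  · grind

theorem Within.irrefl (A : Frame) : ¬ A.Within A := fun h => lt_irrefl _ h.1

theorem Within.trans {A B C : Frame} (h : A.Within B) (h' : B.Within C) : A.Within C :=
  ⟨h'.1.trans h.1, h.2.1.trans h'.2.1, h'.2.2.1.trans h.2.2.1, h.2.2.2.trans h'.2.2.2⟩

theorem Within.startsIn {A B : Frame} (h : A.Within B) : A.StartsIn B :=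
  ⟨h.1, A.hx.trans h.2.1, h.2.2⟩

theorem Enters.startsIn {A B : Frame} (h : A.Enters B) : A.StartsIn B :=
  ⟨h.1, h.2.1, h.2.2.2⟩

theorem inside_iff {A B : Frame} : A.Inside B ↔ A.Within B := by
  have hx := A.hx
  have hy := A.hy
  constructor
  · intro h
    have h1 := h (a := (A.xmin, A.ymin)) (mem_carrier.2 (by grind))
    have h2 := h (a := (A.xmax, A.ymax)) (mem_carrier.2 (by grind))
    exact ⟨h1.1.1, h2.1.2, h1.2.1, h2.2.2⟩
  · rintro ⟨h1, h2, h3, h4⟩ ⟨x, y⟩ h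
    obtain ⟨⟨h5, h6, h7, h8⟩, -⟩ := mem_carrier.1 h
    exact ⟨⟨h1.trans_le h5, h6.trans_lt h2⟩, ⟨h3.trans_le h7, h8.trans_lt h4⟩⟩

theorem Meets.symm {A B : Frame} (h : A.Meets B) : B.Meets A := by
  rwa [Meets, Set.inter_comm] at h

theorem Enters.meets {A B : Frame} (h : A.Enters B) : A.Meets B := by
  have hy := A.hy
  have hx := A.hx
  obtain ⟨h1, h2, h3, h4, h5⟩ := h
  exact ⟨(B.xmax, A.ymin), mem_carrier.2 (by grind), mem_carrier.2 (by grind)⟩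

theorem Within.not_meets {A B : Frame} (h : A.Within B) : ¬ A.Meets B := by
  rintro ⟨⟨x, y⟩, h1, h2⟩
  obtain ⟨h3, h4, h5, h6⟩ := h
  obtain ⟨⟨h7, h8, h9, h10⟩, -⟩ := mem_carrier.1 h1
  obtain ⟨-, h | h | h | h⟩ := mem_carrier.1 h2 <;> linarith

theorem Apart.not_meets {A B : Frame} (h : A.Apart B) : ¬ A.Meets B := by
  rintro ⟨⟨x, y⟩, h1, h2⟩
  obtain ⟨⟨h3, h4, h5, h6⟩, -⟩ := mem_carrier.1 h1
  obtain ⟨⟨h7, h8, h9, h10⟩, -⟩ := mem_carrier.1 h2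
  rcases h with h | h | h | h <;> linarith

/-- The possible relative positions of two distinct frames of a strict set. -/
def Generic (A B : Frame) : Prop :=
  A.Enters B ∨ B.Enters A ∨ A.Within B ∨ B.Within A ∨ A.Apart B

theorem Generic.symm {A B : Frame} (h : A.Generic B) : B.Generic A := by
  unfold Generic Apart at *; tauto

theorem Generic.ne {A B : Frame} (h : A.Generic B) : A ≠ B := by
  rintro rfl
  have hx := A.hx
  have hy := A.hy
  unfold Generic Enters Within Apart at h
  grind

theorem Generic.meets_iff {A B : Frame} (h : A.Generic B) :
    A.Meets B ↔ A.Enters B ∨ B.Enters A := by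
  refine ⟨fun hm => ?_, fun h => h.elim Enters.meets fun h => h.meets.symm⟩
  rcases h with h | h | h | h | h
  · exact .inl h
  · exact .inr h
  · exact absurd hm h.not_meets
  · exact absurd hm.symm h.not_meets
  · exact absurd hm h.not_meets

/-- If the rectangles overlap, the left side of `A` cannot cross the boundary of `B`, so it lies in
the enclosed area. What remains is whether `A` ends before or after the right side of `B`; equality
would put a corner of `A` on `B`. -/
theorem generic_of_left_of_corners {A B : Frame} (hAB : Disjoint A.leftSide B.carrier)
    (cAB : Disjoint A.corners B.carrier) (hlt : B.xmin < A.xmin) : A.Generic B := by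
  have hAx := A.hx
  have hAy := A.hy
  have hBx := B.hx
  have hBy := B.hy
  by_cases hap : A.Apart B
  · exact .inr (.inr (.inr (.inr hap)))
  have hl : ∀ y, A.ymin ≤ y → y ≤ A.ymax → (A.xmin, y) ∉ B.carrier := fun y h1 h2 =>
    Set.disjoint_left.1 hAB ⟨rfl, h1, h2⟩
  have hc : (A.xmax, A.ymin) ∉ B.carrier := Set.disjoint_left.1 cAB (by simp [corners])
  simp only [Apart, not_or, not_lt] at hap
  obtain ⟨h1, h2, h3, h4⟩ := hap
  simp only [mem_carrier] at hl hc
  have hymin : B.ymin < A.ymin := by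
    by_contra! h
    exact hl B.ymin h h3 (by grind)
  have hymax : A.ymax < B.ymax := by
    by_contra! h
    exact hl B.ymax h4 h (by grind)
  have hmax : A.xmin < B.xmax := by
    by_contra! h
    exact hl A.ymin le_rfl hAy.le (by grind)
  rcases lt_trichotomy A.xmax B.xmax with h | h | h
  · exact .inr (.inr (.inl ⟨hlt, h, hymin, hymax⟩))
  · exact absurd ⟨by grind, .inr (.inl h)⟩ hc
  · exact .inl ⟨hlt, hmax, h, hymin, hymax⟩

end Frame

/-! ### Strict sets as arrangements -/

open Frame

theorem IsRestricted.generic {F : Set Frame} (hF : IsRestricted F) {A B : Frame} (hA : A ∈ F)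
    (hB : B ∈ F) (h : A ≠ B) : A.Generic B := by
  rcases lt_trichotomy A.xmin B.xmin with hx | hx | hx
  · exact (generic_of_left_of_corners (hF.left B hB A hA h.symm) (hF.corners B hB A hA h.symm)
      hx).symm
  · by_cases hap : A.Apart B
    · exact .inr (.inr (.inr (.inr hap)))
    have hl := hF.left A hA B hB h
    simp only [Apart, not_or, not_lt] at hap
    have hAy := A.hy
    have hBy := B.hy
    have hBx := B.hx
    -- With aligned left sides and overlapping vertical ranges, this point is on both left sides.
    have hl' : (A.xmin, max A.ymin B.ymin) ∉ B.carrier :=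
      Set.disjoint_left.1 hl ⟨rfl, le_max_left _ _, by simp [hAy.le, hap]⟩
    refine absurd (mem_carrier.2 ?_) hl'
    refine ⟨⟨hx.ge, hx.le.trans hBx.le, le_max_right _ _, by simp [hBy.le, hap]⟩, .inl hx⟩
  · exact generic_of_left_of_corners (hF.left A hA B hB h) (hF.corners A hA B hB h) hx

/-- A family of frames whose range is a strict set, in coordinates. -/
structure IsArrangement {ι : Type*} (f : ι → Frame) : Prop where
  generic : ∀ i j, i ≠ j → (f i).Generic (f j)
  not_startsIn : ∀ i j k, (f i).Enters (f j) → (f k).StartsIn (f i) → ¬ (f k).StartsIn (f j)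

/-- When `A` enters `B` and `C` starts in both, each way for `C` to end is excluded by a different
condition: inside both by `inter`, inside `A` only by `strict`, inside `B` only by comparing right
sides, and inside neither by triangle-freeness. -/
theorem IsStrict.isArrangement {F : Set Frame} (hF : IsStrict F) :
    IsArrangement (Subtype.val : F → Frame) where
  generic A B h := hF.generic A.2 B.2 fun h' => h (Subtype.ext h')
  not_startsIn := by
    rintro ⟨A, hA⟩ ⟨B, hB⟩ ⟨C, hC⟩ hAB hCA hCB
    simp only at hAB hCA hCB
    classical
    have hxC := C.hx
    have hyC := C.hy
    have hCA' : C ≠ A := by rintro rfl; exact lt_irrefl _ hCA.1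
    have hCB' : C ≠ B := by rintro rfl; exact lt_irrefl _ hCB.1
    have key : ∀ D ∈ F, C ≠ D → C.StartsIn D → C.Within D ∨ C.Enters D := by
      intro D hD hCD h
      have := hF.generic hC hD hCD
      unfold Generic Enters Within Apart at *
      unfold StartsIn at h
      grind
    have hne : A ≠ B := by rintro rfl; exact lt_irrefl _ hAB.1
    rcases key A hA hCA' hCA with h1 | h1 <;> rcases key B hB hCB' hCB with h2 | h2
    · refine hF.inter A hA B hB hne hAB.meets C hC fun p hp => ?_
      have h3 := inside_iff.2 h1 hp
      have h4 := inside_iff.2 h2 hp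
      exact ⟨⟨⟨h3.1.1.le, h3.1.2.le⟩, ⟨h3.2.1.le, h3.2.2.le⟩⟩,
        ⟨⟨h4.1.1.le, h4.1.2.le⟩, ⟨h4.2.1.le, h4.2.2.le⟩⟩⟩
    -- Here `B` meets the nested pair `C`, `A`, so strictness makes `B` enter `C`, while `C` enters
    -- `B`.
    · have h3 := (hF.strict C hC A hA (inside_iff.2 h1) B hB h2.meets.symm hAB.meets.symm).1
      exact lt_asymm h3.1 h2.1
    · exact lt_asymm h2.2.1 (hAB.2.2.1.trans h1.2.2.1)
    · have e1 : (frameIntersectionGraph F).Adj ⟨C, hC⟩ ⟨A, hA⟩ :=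
        ⟨fun h => hCA' (congrArg Subtype.val h), h1.meets⟩
      have e2 : (frameIntersectionGraph F).Adj ⟨C, hC⟩ ⟨B, hB⟩ :=
        ⟨fun h => hCB' (congrArg Subtype.val h), h2.meets⟩
      have e3 : (frameIntersectionGraph F).Adj ⟨A, hA⟩ ⟨B, hB⟩ :=
        ⟨fun h => hne (congrArg Subtype.val h), hAB.meets⟩
      exact hF.triangleFree _ (SimpleGraph.is3Clique_triple_iff.2 ⟨e1, e2, e3⟩)

namespace IsArrangement

variable {ι : Type*} {f : ι → Frame}

theorem injective (hf : IsArrangement f) : Function.Injective f := fun i j h =>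
  by_contra fun h' => (hf.generic i j h').ne h

theorem enters_or_within (hf : IsArrangement f) {i j : ι} (h : (f i).StartsIn (f j)) :
    (f i).Enters (f j) ∨ (f i).Within (f j) := by
  have hij : i ≠ j := by rintro rfl; exact lt_irrefl _ h.1
  have := hf.generic i j hij
  have := (f i).hx
  have := (f i).hy
  unfold Generic Enters Within Apart at *
  unfold StartsIn at h
  grind

/-- Two frames around the left side of a third frame are nested. -/
theorem comparable (hf : IsArrangement f) {i j k : ι} (hj : (f i).StartsIn (f j))
    (hk : (f i).StartsIn (f k)) : j = k ∨ (f j).Within (f k) ∨ (f k).Within (f j) := by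
  by_cases h : j = k
  · exact .inl h
  rcases hf.generic j k h with h | h | h | h | h
  · exact absurd hk (hf.not_startsIn _ _ _ h hj)
  · exact absurd hj (hf.not_startsIn _ _ _ h hk)
  · exact .inr (.inl h)
  · exact .inr (.inr h)
  · exfalso
    have := (f i).hy
    unfold Apart at h
    unfold StartsIn at hj hk
    grind

/-- Both `f j` and `f k` surround the left side of `f i`, so they are comparable; `f i` sticks out
of `f j` but not of `f k`, so `f k` is the outer one. -/
theorem within_of_enters_of_within (hf : IsArrangement f) {i j k : ι} (hj : (f i).Enters (f j))
    (hk : (f i).Within (f k)) : (f j).Within (f k) := by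
  rcases hf.comparable hj.startsIn hk.startsIn with rfl | h | h
  · exact absurd hk.2.1 hj.2.2.1.not_gt
  · exact h
  · exact absurd (hk.trans h).2.1 hj.2.2.1.not_gt

theorem enters_or_within_of_enters_of_within (hf : IsArrangement f) {i j k : ι}
    (hj : (f i).Enters (f j)) (hk : (f j).Within (f k)) :
    (f i).Enters (f k) ∨ (f i).Within (f k) := by
  apply hf.enters_or_within
  unfold Enters Within at *
  unfold StartsIn
  grind

theorem isStrict_range (hf : IsArrangement f) : IsStrict (Set.range f) where
  triangleFree := by
    classical
    intro s hs
    obtain ⟨⟨_, i, rfl⟩, ⟨_, j, rfl⟩, ⟨_, k, rfl⟩, h1, h2, h3, -⟩ :=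
      SimpleGraph.is3Clique_iff.1 hs
    -- In a triangle, the frame whose left side is farthest right enters the other two; these are
    -- then nested, so they do not meet.
    have key : ∀ i j k, (f i).Meets (f j) → (f i).Meets (f k) → f j ≠ f k → (f j).Meets (f k) →
        (f j).xmin ≤ (f i).xmin → (f k).xmin ≤ (f i).xmin → f i ≠ f j → f i ≠ f k → False := by
      intro i j k hij hik hjk hjk' hx1 hx2 ne1 ne2
      have e1 : (f i).Enters (f j) := ((hf.generic i j (ne_of_apply_ne f ne1)).meets_iff.1
        hij).resolve_right fun h => hx1.not_gt h.1
      have e2 : (f i).Enters (f k) := ((hf.generic i k (ne_of_apply_ne f ne2)).meets_iff.1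
        hik).resolve_right fun h => hx2.not_gt h.1
      rcases hf.comparable e1.startsIn e2.startsIn with h | h | h
      · exact hjk (congrArg f h)
      · exact h.not_meets hjk'
      · exact h.not_meets hjk'.symm
    have n1 : f i ≠ f j := fun h => h1.1 (Subtype.ext h)
    have n2 : f i ≠ f k := fun h => h2.1 (Subtype.ext h)
    have n3 : f j ≠ f k := fun h => h3.1 (Subtype.ext h)
    rcases le_total (f i).xmin (f j).xmin with hij | hij <;>
    rcases le_total (f i).xmin (f k).xmin with hik | hik <;>
    rcases le_total (f j).xmin (f k).xmin with hjk | hjk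
    · exact key k i j h2.2.symm h3.2.symm n1 h1.2 hik hjk n2.symm n3.symm
    · exact key j i k h1.2.symm h3.2 n2 h2.2 hij hjk n1.symm n3
    · exact key k i j h2.2.symm h3.2.symm n1 h1.2 (hij.trans hjk) hjk n2.symm n3.symm
    · exact key j i k h1.2.symm h3.2 n2 h2.2 hij hjk n1.symm n3
    · exact key k i j h2.2.symm h3.2.symm n1 h1.2 hik hjk n2.symm n3.symm
    · exact key i j k h1.2 h2.2 n3 h3.2 hij (hjk.trans hij) n1 n2
    · exact key i j k h1.2 h2.2 n3 h3.2 hij hik n1 n2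
    · exact key i j k h1.2 h2.2 n3 h3.2 hij hik n1 n2
  corners := by
    rintro _ ⟨i, rfl⟩ _ ⟨j, rfl⟩ h
    have hg := hf.generic i j (ne_of_apply_ne f h)
    have := (f i).hx
    have := (f i).hy
    have := (f j).hx
    have := (f j).hy
    rw [Set.disjoint_left]
    rintro ⟨x, y⟩ hx hy
    rw [mem_carrier] at hy
    simp only [corners, Set.mem_insert_iff, Prod.mk.injEq, Set.mem_singleton_iff] at hx
    unfold Generic Enters Within Apart at hg
    grind
  left := by
    rintro _ ⟨i, rfl⟩ _ ⟨j, rfl⟩ h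
    have hg := hf.generic i j (ne_of_apply_ne f h)
    have := (f i).hx
    have := (f i).hy
    have := (f j).hx
    have := (f j).hy
    rw [Set.disjoint_left]
    rintro ⟨x, y⟩ hx hy
    rw [mem_carrier] at hy
    simp only [leftSide, Set.mem_prod, Set.mem_singleton_iff, Set.mem_Icc] at hx
    unfold Generic Enters Within Apart at hg
    grind
  right := by
    rintro _ ⟨i, rfl⟩ _ ⟨j, rfl⟩ h ⟨⟨x, y⟩, hx, hy⟩
    have hg := hf.generic i j (ne_of_apply_ne f h)
    have := (f i).hx
    have := (f i).hy
    have := (f j).hx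
    have := (f j).hy
    have he : (f j).Enters (f i) := by
      rw [mem_carrier] at hy
      simp only [rightSide, Set.mem_prod, Set.mem_singleton_iff, Set.mem_Icc] at hx
      unfold Generic Enters Within Apart at hg
      unfold Enters
      grind
    obtain ⟨h1, h2, h3, h4, h5⟩ := he
    exact ⟨⟨((f i).xmax, (f j).ymax), ⟨rfl, by grind, by grind⟩, ⟨⟨h2.le, h3.le⟩, rfl⟩⟩,
      ⟨((f i).xmax, (f j).ymin), ⟨rfl, by grind, by grind⟩, ⟨⟨h2.le, h3.le⟩, rfl⟩⟩⟩
  inter := by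
    rintro _ ⟨i, rfl⟩ _ ⟨j, rfl⟩ h hm _ ⟨k, rfl⟩ hk
    have key : ∀ i j, (f i).Enters (f j) → ¬ (f k).carrier ⊆ (f i).region ∩ (f j).region := by
      intro i j he hk
      have hx := (f k).hx
      have hy := (f k).hy
      have h1 := hk (a := ((f k).xmin, (f k).ymin)) (mem_carrier.2 (by grind))
      have h2 := hk (a := ((f k).xmax, (f k).ymax)) (mem_carrier.2 (by grind))
      simp only [region, Set.mem_inter_iff, Set.mem_prod, Set.mem_Icc] at h1 h2
      have hki : k ≠ i := by rintro rfl; exact he.2.2.1.not_ge h2.2.1.2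
      have hkj : k ≠ j := by rintro rfl; exact he.1.not_ge h1.1.1.1
      have gi := hf.generic k i hki
      have gj := hf.generic k j hkj
      refine hf.not_startsIn i j k he ?_ ?_ <;>
      · unfold Generic Enters Within Apart at gi gj
        unfold StartsIn
        grind
    rcases (hf.generic i j (ne_of_apply_ne f h)).meets_iff.1 hm with he | he
    · exact key i j he hk
    · exact key j i he (by rwa [Set.inter_comm])
  strict := by
    rintro _ ⟨i, rfl⟩ _ ⟨j, rfl⟩ h _ ⟨k, rfl⟩ hi hj
    rw [inside_iff] at h
    have hki : k ≠ i := by rintro rfl; exact h.not_meets hj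
    have hkj : k ≠ j := by rintro rfl; exact h.not_meets hi.symm
    have hi' : (f k).Enters (f i) := by
      refine ((hf.generic k i hki).meets_iff.1 hi).resolve_right fun h' => ?_
      exact (hf.within_of_enters_of_within h' h).not_meets hj
    exact ⟨hi', (hf.enters_or_within_of_enters_of_within hi' h).resolve_right
      fun h' => h'.not_meets hj⟩

end IsArrangement

/-! ### Adjacency and stable sets after one Burling step -/

namespace StablePair

variable {P : StablePair}

/-- A vertex of the copy of `P` in `P.next`. -/
def base (v : P.V) : P.next.V := NextVertex.base v

/-- A vertex of the copy of `P` attached to `S` in `P.next`. -/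
def copy (S : P.sets) (v : P.V) : P.next.V := NextVertex.copy S v

/-- The vertex `v_{S,Q}` of `P.next`. -/
def new (S Q : P.sets) : P.next.V := NextVertex.new S Q

theorem next_cases (v : P.next.V) :
    (∃ u, v = base u) ∨ (∃ S u, v = copy S u) ∨ ∃ S Q, v = new S Q := by
  rcases v with u | ⟨S, u⟩ | ⟨S, Q⟩
  · exact .inl ⟨u, rfl⟩
  · exact .inr (.inl ⟨S, u, rfl⟩)
  · exact .inr (.inr ⟨S, Q, rfl⟩)

section eq

variable {S Q T R : P.sets} {v w : P.V}

@[simp]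
theorem base_inj : base v = base w ↔ v = w :=
  ⟨NextVertex.base.inj, fun h => h ▸ rfl⟩

@[simp]
theorem copy_inj : copy S v = copy T w ↔ S = T ∧ v = w :=
  ⟨NextVertex.copy.inj, by rintro ⟨rfl, rfl⟩; rfl⟩

@[simp]
theorem new_inj : new S Q = new T R ↔ S = T ∧ Q = R :=
  ⟨NextVertex.new.inj, by rintro ⟨rfl, rfl⟩; rfl⟩

@[simp]
theorem base_ne_copy : base v ≠ copy S w := nofun

@[simp]
theorem base_ne_new : base v ≠ new S Q := nofun

@[simp]
theorem copy_ne_base : copy S w ≠ base v := nofun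

@[simp]
theorem copy_ne_new : copy T w ≠ new S Q := nofun

@[simp]
theorem new_ne_base : new S Q ≠ base v := nofun

@[simp]
theorem new_ne_copy : new S Q ≠ copy T v := nofun

end eq

section adj

variable {S Q T R : P.sets} {v w : P.V}

@[simp]
theorem adj_base_base : P.next.graph.Adj (base v) (base w) ↔ P.graph.Adj v w :=
  ⟨fun h => by cases h with | base h => exact h, .base⟩

@[simp]
theorem adj_copy_copy :
    P.next.graph.Adj (copy S v) (copy T w) ↔ S = T ∧ P.graph.Adj v w :=
  ⟨fun h => by cases h with | copy _ h => exact ⟨rfl, h⟩, by rintro ⟨rfl, h⟩; exact .copy S h⟩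

@[simp]
theorem adj_new_copy : P.next.graph.Adj (new S Q) (copy T v) ↔ S = T ∧ v ∈ Q.1 :=
  ⟨fun h => by cases h with | newCopy _ _ h => exact ⟨rfl, h⟩,
    by rintro ⟨rfl, h⟩; exact .newCopy S Q h⟩

@[simp]
theorem adj_copy_new : P.next.graph.Adj (copy T v) (new S Q) ↔ S = T ∧ v ∈ Q.1 := by
  rw [SimpleGraph.adj_comm, adj_new_copy]

@[simp]
theorem not_adj_base_copy : ¬ P.next.graph.Adj (base v) (copy S w) := fun h => by cases h

@[simp]
theorem not_adj_copy_base : ¬ P.next.graph.Adj (copy S w) (base v) := fun h => by cases h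

@[simp]
theorem not_adj_base_new : ¬ P.next.graph.Adj (base v) (new S Q) := fun h => by cases h

@[simp]
theorem not_adj_new_base : ¬ P.next.graph.Adj (new S Q) (base v) := fun h => by cases h

@[simp]
theorem not_adj_new_new : ¬ P.next.graph.Adj (new S Q) (new T R) := fun h => by cases h

end adj

/-- The stable set `S ∪ Q` of the next pair. -/
def unionCopy (S Q : P.sets) : P.next.sets := ⟨base '' S.1 ∪ copy S '' Q.1, S, Q, .inl rfl⟩

/-- The stable set `S ∪ {v_{S,Q}}` of the next pair. -/
def unionNew (S Q : P.sets) : P.next.sets := ⟨base '' S.1 ∪ {new S Q}, S, Q, .inr rfl⟩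

theorem eq_union (X : P.next.sets) : ∃ S Q, X = unionCopy S Q ∨ X = unionNew S Q := by
  obtain ⟨X, S, Q, h⟩ := X
  exact ⟨S, Q, h.imp Subtype.ext Subtype.ext⟩

section mem

variable {S Q T R : P.sets} {v : P.V}

@[simp]
theorem base_mem_unionCopy : base v ∈ (unionCopy S Q).1 ↔ v ∈ S.1 := by
  simp [unionCopy]

@[simp]
theorem copy_mem_unionCopy : copy T v ∈ (unionCopy S Q).1 ↔ S = T ∧ v ∈ Q.1 := by
  simp only [unionCopy, Set.mem_union, Set.mem_image, copy_inj, base_ne_copy]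
  grind

@[simp]
theorem new_notMem_unionCopy : new T R ∉ (unionCopy S Q).1 := by
  simp [unionCopy]

@[simp]
theorem base_mem_unionNew : base v ∈ (unionNew S Q).1 ↔ v ∈ S.1 := by
  simp [unionNew]

@[simp]
theorem copy_notMem_unionNew : copy T v ∉ (unionNew S Q).1 := by
  simp [unionNew]

@[simp]
theorem new_mem_unionNew : new T R ∈ (unionNew S Q).1 ↔ T = S ∧ R = Q := by
  simp [unionNew]

end mem

/-! ### Embedding arrangements in Burling graphs -/

/-- The finite set `s` is embedded in `P` in such a way that edges are the pairs related by `en`,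
and that every principal up-set of `s` for `lt` and the empty set are traces of stable sets
of `P`. -/
def Represents {α : Type*} (lt en : α → α → Prop) (s : Finset α) (P : StablePair) : Prop :=
  ∃ e : α → P.V, Set.InjOn e s ∧
    (∀ x ∈ s, ∀ y ∈ s, P.graph.Adj (e x) (e y) ↔ en x y ∨ en y x) ∧
    (∀ y ∈ s, ∃ Q : P.sets, ∀ z ∈ s, e z ∈ Q.1 ↔ y = z ∨ lt y z) ∧
    ∃ Q : P.sets, ∀ z ∈ s, e z ∉ Q.1

theorem Represents.next {α : Type*} {lt en : α → α → Prop} {s : Finset α}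
    (h : Represents lt en s P) : Represents lt en s P.next := by
  obtain ⟨e, h1, h2, h3, Q, hQ⟩ := h
  refine ⟨fun x => base (e x), fun x hx y hy h => h1 hx hy (base_inj.1 h),
    fun x hx y hy => adj_base_base.trans (h2 x hx y hy), fun y hy => ?_, unionCopy Q Q,
    fun z hz h => hQ z hz (base_mem_unionCopy.1 h)⟩
  obtain ⟨R, hR⟩ := h3 y hy
  exact ⟨unionCopy R R, fun z hz => base_mem_unionCopy.trans (hR z hz)⟩

open Classical in
/-- Extending a representation by a new `lt`-maximal element `x` without in-neighbours, and by the
elements below `x`. -/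
theorem Represents.glue {α : Type*} {lt en : α → α → Prop} {s : Finset α} {x : α} (hx : x ∈ s)
    (h1 : Represents lt en {z ∈ s | z ≠ x ∧ ¬ lt z x} P)
    (h2 : Represents lt en {z ∈ s | lt z x} P)
    (irrefl : ∀ z, ¬ lt z z) (en_irrefl : ¬ en x x)
    (max : ∀ z ∈ s, ¬ lt x z) (source : ∀ z ∈ s, ¬ en z x)
    (out : (∀ z ∈ s, ¬ en x z) ∨ ∃ y ∈ s, y ≠ x ∧ ¬ lt y x ∧
      ∀ z ∈ s, ¬ lt z x → (en x z ↔ y = z ∨ lt y z))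
    (outBelow : ∀ z ∈ s, lt z x → ¬ en x z)
    (cross : ∀ y ∈ s, ∀ z ∈ s, y ≠ x → ¬ lt y x → lt z x →
      ¬ lt y z ∧ ¬ lt z y ∧ ¬ en y z ∧ ¬ en z y) :
    Represents lt en s P.next.next := by
  obtain ⟨e, e1, e2, e3, N, e4⟩ := h1
  obtain ⟨d, d1, d2, d3, M, d4⟩ := h2
  simp only [Finset.mem_filter, and_imp] at e2 e3 e4 d2 d3 d4
  -- `R` traces the out-neighborhood of `x`, which is empty or a principal up-set.
  obtain ⟨R, hR⟩ : ∃ R : P.sets, ∀ z ∈ s, z ≠ x → ¬ lt z x → (e z ∈ R.1 ↔ en x z) := by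
    rcases out with h | ⟨y, hy, hyx, hyx', h⟩
    · exact ⟨N, fun z hz hzx hzx' => by simp [e4 z hz hzx hzx', h z hz]⟩
    · obtain ⟨R, hR⟩ := e3 y hy hyx hyx'
      exact ⟨R, fun z hz hzx hzx' => (hR z hz hzx hzx').trans (h z hz hzx').symm⟩
  -- The first step puts the outer elements in the copy attached to `N` and makes `x` the vertex
  -- `new N R`. The second puts the elements below `x` in the copy attached to `unionNew N R`, which
  -- among the outer elements and `x` contains only `x`.
  let g : α → P.next.next.V := fun z =>
    if z = x then base (new N R)
    else if lt z x then copy (unionNew N R) (base (d z))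
    else base (copy N (e z))
  have gx : g x = base (new N R) := if_pos rfl
  have gd : ∀ z, lt z x → g z = copy (unionNew N R) (base (d z)) := by
    intro z hz
    have : z ≠ x := by rintro rfl; exact irrefl _ hz
    simp only [g]
    rw [if_neg this, if_pos hz]
  have ge : ∀ z, z ≠ x → ¬ lt z x → g z = base (copy N (e z)) := by
    intro z h h'
    simp only [g]
    rw [if_neg h, if_neg h']
  have cases : ∀ z, z = x ∨ lt z x ∨ (z ≠ x ∧ ¬ lt z x) := fun z => by tauto
  refine ⟨g, ?_, ?_, ?_, ?_⟩
  · intro y hy z hz h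
    rcases cases y with rfl | hy' | ⟨hy', hy''⟩ <;> rcases cases z with rfl | hz' | ⟨hz', hz''⟩
    · rfl
    · simp [gx, gd _ hz'] at h
    · simp [gx, ge _ hz' hz''] at h
    · simp [gx, gd _ hy'] at h
    · rw [gd _ hy', gd _ hz'] at h
      exact d1 (by simpa using ⟨hy, hy'⟩) (by simpa using ⟨hz, hz'⟩) (by simpa using h)
    · simp [gd _ hy', ge _ hz' hz''] at h
    · simp [gx, ge _ hy' hy''] at h
    · simp [gd _ hz', ge _ hy' hy''] at h
    · rw [ge _ hy' hy'', ge _ hz' hz''] at h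
      exact e1 (by simpa using ⟨hy, hy', hy''⟩) (by simpa using ⟨hz, hz', hz''⟩) (by simpa using h)
  · intro y hy z hz
    rcases cases y with rfl | hy' | ⟨hy', hy''⟩ <;> rcases cases z with rfl | hz' | ⟨hz', hz''⟩
    · simp [gx, en_irrefl]
    · rw [gx, gd _ hz']
      simp [outBelow z hz hz', source z hz]
    · rw [gx, ge _ hz' hz'']
      simp [hR z hz hz' hz'', source z hz]
    · rw [gx, gd _ hy']
      simp [outBelow y hy hy', source y hy]
    · rw [gd _ hy', gd _ hz']
      simp [d2 y hy hy' z hz hz']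
    · rw [gd _ hy', ge _ hz' hz'']
      simp [cross z hz y hy hz' hz'' hy']
    · rw [gx, ge _ hy' hy'']
      simp [hR y hy hy' hy'', source y hy]
    · rw [gd _ hz', ge _ hy' hy'']
      simp [cross y hy z hz hy' hy'' hz']
    · rw [ge _ hy' hy'', ge _ hz' hz'']
      simp [e2 y hy hy' hy'' z hz hz' hz'']
  · intro y hy
    rcases cases y with rfl | hy' | ⟨hy', hy''⟩
    · refine ⟨unionCopy (unionNew N R) (unionCopy M M), fun z hz => ?_⟩
      rcases cases z with rfl | hz' | ⟨hz', hz''⟩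
      · simp [gx]
      · rw [gd _ hz']
        have : y ≠ z := by rintro rfl; exact irrefl _ hz'
        simp [d4 z hz hz', max z hz, this]
      · rw [ge _ hz' hz'']
        simp [max z hz, hz'.symm]
    · obtain ⟨Q, hQ⟩ := d3 y hy hy'
      refine ⟨unionCopy (unionNew N R) (unionCopy Q Q), fun z hz => ?_⟩
      rcases cases z with rfl | hz' | ⟨hz', hz''⟩
      · simp [gx, hy']
      · rw [gd _ hz']
        simp [hQ z hz hz']
      · rw [ge _ hz' hz'']
        have : y ≠ z := by rintro rfl; exact hz'' hy'
        simp [cross z hz y hy hz' hz'' hy', this]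
    · obtain ⟨Q, hQ⟩ := e3 y hy hy' hy''
      -- The base part selects outer elements through `Q` and omits `x`; the extra new vertex is
      -- outside the image of `g`, and no vertex of an attached copy is selected.
      refine ⟨unionNew (unionCopy N Q) (unionCopy N Q), fun z hz => ?_⟩
      rcases cases z with rfl | hz' | ⟨hz', hz''⟩
      · simp [gx, hy', hy'']
      · rw [gd _ hz']
        have : y ≠ z := by rintro rfl; exact hy'' hz'
        simp [cross y hy z hz hy' hy'' hz', this]
      · rw [ge _ hz' hz'']
        simp [hQ z hz hz' hz'']
  · refine ⟨unionNew (unionCopy N N) (unionCopy N N), fun z hz => ?_⟩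
    rcases cases z with rfl | hz' | ⟨hz', hz''⟩
    · simp [gx]
    · rw [gd _ hz']
      simp
    · rw [ge _ hz' hz'']
      simp [e4 z hz hz' hz'']

end StablePair

open StablePair

namespace StablePair

theorem Represents.mono {α : Type*} {lt en : α → α → Prop} {s : Finset α} {k l : ℕ}
    (h : Represents lt en s (burlingPair k)) (hkl : k ≤ l) :
    Represents lt en s (burlingPair l) := by
  induction hkl with
  | refl => exact h
  | step _ ih => exact ih.next

end StablePair

namespace IsArrangement

variable {ι : Type*} {f : ι → Frame}

/-- Only adjacency matters in the end; the traces of stable sets strengthen the induction so that a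
further frame can be attached. -/
theorem exists_represents (hf : IsArrangement f) (s : Finset ι) :
    ∃ k, Represents (fun i j => (f i).Within (f j)) (fun i j => (f i).Enters (f j)) s
      (burlingPair k) := by
  classical
  induction s using Finset.strongInduction with
  | H s ih =>
  rcases s.eq_empty_or_nonempty with rfl | hs
  · exact ⟨0, fun _ => (), by simp [Set.InjOn], by simp, by simp, ⟨Set.univ, rfl⟩, by simp⟩
  let roots : Finset ι := {x ∈ s | ∀ z ∈ s, ¬ (f x).Within (f z)}
  have hroots : roots.Nonempty := by
    obtain ⟨x, hx, hmin⟩ := s.exists_min_image (fun x => (f x).xmin) hs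
    exact ⟨x, Finset.mem_filter.2 ⟨hx, fun z hz h => (hmin z hz).not_gt h.1⟩⟩
  obtain ⟨x, hx, hmax⟩ := roots.exists_max_image (fun x => (f x).xmin) hroots
  obtain ⟨hxs, hxroot⟩ := Finset.mem_filter.1 hx
  -- A frame entering `f x` would also be a root, since any frame around it would contain `f x`, and
  -- its left side would be farther right.
  have source : ∀ z ∈ s, ¬ (f z).Enters (f x) := by
    intro z hz h
    refine (hmax z (Finset.mem_filter.2 ⟨hz, fun w hw hzw => ?_⟩)).not_gt h.1
    exact hxroot w hw (hf.within_of_enters_of_within h hzw)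
  obtain ⟨k, hk⟩ := ih {z ∈ s | z ≠ x ∧ ¬ (f z).Within (f x)}
    (Finset.filter_ssubset.2 ⟨x, hxs, by simp⟩)
  obtain ⟨l, hl⟩ := ih {z ∈ s | (f z).Within (f x)}
    (Finset.filter_ssubset.2 ⟨x, hxs, Within.irrefl _⟩)
  have outBelow : ∀ z, (f z).Within (f x) → ¬ (f x).Enters (f z) := fun z h h' =>
    h.not_meets h'.meets.symm
  refine ⟨max k l + 2, Represents.glue hxs (hk.mono (le_max_left k l)) (hl.mono (le_max_right k l))
    (fun _ => Within.irrefl _) (fun h => lt_irrefl _ h.1) hxroot source ?_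
    (fun z _ => outBelow z) ?_⟩
  · let outs : Finset ι := {z ∈ s | (f x).Enters (f z)}
    rcases outs.eq_empty_or_nonempty with h | h
    · exact .inl (by simpa [outs, Finset.filter_eq_empty_iff] using h)
    -- The out-neighbors form a chain, so the largest `xmin` picks the innermost. A frame around it
    -- also contains the left side of `f x`, and is entered because `f x` is a root.
    obtain ⟨y, hy, hymax⟩ := outs.exists_max_image (fun z => (f z).xmin) h
    obtain ⟨hys, hxy⟩ := Finset.mem_filter.1 hy
    refine .inr ⟨y, hys, ?_, fun h => outBelow y h hxy, fun z hz hzx => ⟨fun h => ?_, ?_⟩⟩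
    · rintro rfl
      exact lt_irrefl _ hxy.1
    · rcases hf.comparable hxy.startsIn h.startsIn with h' | h' | h'
      · exact .inl h'
      · exact .inr h'
      · exact absurd h'.1 (hymax z (Finset.mem_filter.2 ⟨hz, h⟩)).not_gt
    · rintro (rfl | h)
      · exact hxy
      · exact (hf.enters_or_within_of_enters_of_within hxy h).resolve_right (hxroot z hz)
  · intro y hy z hz hyx hyx' hzx
    refine ⟨fun h => hyx' (h.trans hzx), fun h => ?_, fun h => ?_,
      fun h => hyx' (hf.within_of_enters_of_within h hzx)⟩
    · rcases hf.comparable hzx.startsIn h.startsIn with h' | h' | h'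
      · exact hyx h'.symm
      · exact hxroot y hy h'
      · exact hyx' h'
    · exact (hf.enters_or_within_of_enters_of_within h hzx).elim (source y hy) hyx'

end IsArrangement

theorem IsStrictFrameGraph.isBurlingGraph {V : Type*} [Finite V] {G : SimpleGraph V}
    (h : IsStrictFrameGraph G) : IsBurlingGraph G := by
  obtain ⟨F, hF, ⟨φ⟩⟩ := h
  have : Finite F := Finite.of_equiv V φ.toEquiv
  cases nonempty_fintype F
  obtain ⟨k, e, he, hadj, -⟩ := hF.isArrangement.exists_represents Finset.univ
  have hinj : Function.Injective e := fun x y h => he (by simp) (by simp) h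
  refine ⟨k, Set.range e, ⟨φ.trans ⟨Equiv.ofInjective e hinj, ?_⟩⟩⟩
  intro A B
  refine (hadj A (by simp) B (by simp)).trans ⟨fun h => ?_, fun h => ?_⟩
  · refine ⟨?_, h.elim Enters.meets fun h => h.meets.symm⟩
    rintro rfl
    exact h.elim (fun h => lt_irrefl _ h.1) fun h => lt_irrefl _ h.1
  · exact (hF.isArrangement.generic A B h.1).meets_iff.1 h.2

/-! ### Rescaling frames and placing new ones -/

/-- A strictly increasing map from the real line into the interval `(l, r)`. -/
noncomputable def squeeze (l r t : ℝ) : ℝ := l + (r - l) * Real.sigmoid t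

section squeeze

variable {l r : ℝ} (h : l < r)

include h

theorem squeeze_lt_squeeze {s t : ℝ} : squeeze l r s < squeeze l r t ↔ s < t := by
  have : StrictMono (squeeze l r) := fun s t hst => by
    unfold squeeze
    have := mul_lt_mul_of_pos_left (Real.sigmoid_strictMono hst) (sub_pos.2 h)
    linarith
  exact this.lt_iff_lt

theorem lt_squeeze (t : ℝ) : l < squeeze l r t := by
  have := mul_pos (sub_pos.2 h) (Real.sigmoid_pos t)
  unfold squeeze
  linarith

theorem squeeze_lt (t : ℝ) : squeeze l r t < r := by
  have := mul_lt_mul_of_pos_left (Real.sigmoid_lt_one t) (sub_pos.2 h)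
  unfold squeeze
  linarith

end squeeze

namespace Frame

/-- The first coordinate of the midpoint of the rectangle. -/
noncomputable def xmid (R : Frame) : ℝ := (R.xmin + R.xmax) / 2

theorem xmin_lt_xmid (R : Frame) : R.xmin < R.xmid := by
  have := R.hx
  unfold xmid
  linarith

theorem xmid_lt_xmax (R : Frame) : R.xmid < R.xmax := by
  have := R.hx
  unfold xmid
  linarith

/-- The image of `A` under a monotone map of the plane into the left half of the rectangle
bounded by `R`. -/
noncomputable def squeezeInto (R A : Frame) : Frame where
  xmin := squeeze R.xmin R.xmid A.xmin
  xmax := squeeze R.xmin R.xmid A.xmax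
  ymin := squeeze R.ymin R.ymax A.ymin
  ymax := squeeze R.ymin R.ymax A.ymax
  hx := (squeeze_lt_squeeze R.xmin_lt_xmid).2 A.hx
  hy := (squeeze_lt_squeeze R.hy).2 A.hy

section squeezeInto

variable {R A B : Frame}

theorem xmin_lt_squeezeInto : R.xmin < (R.squeezeInto A).xmin := lt_squeeze R.xmin_lt_xmid _

theorem squeezeInto_lt_xmid : (R.squeezeInto A).xmax < R.xmid := squeeze_lt R.xmin_lt_xmid _

theorem squeezeInto_within : (R.squeezeInto A).Within R :=
  ⟨xmin_lt_squeezeInto, squeezeInto_lt_xmid.trans R.xmid_lt_xmax, lt_squeeze R.hy _,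
    squeeze_lt R.hy _⟩

@[simp]
theorem squeezeInto_xmin_lt_xmin :
    (R.squeezeInto A).xmin < (R.squeezeInto B).xmin ↔ A.xmin < B.xmin :=
  squeeze_lt_squeeze R.xmin_lt_xmid

@[simp]
theorem squeezeInto_xmin_lt_xmax :
    (R.squeezeInto A).xmin < (R.squeezeInto B).xmax ↔ A.xmin < B.xmax :=
  squeeze_lt_squeeze R.xmin_lt_xmid

@[simp]
theorem squeezeInto_xmax_lt_xmin :
    (R.squeezeInto A).xmax < (R.squeezeInto B).xmin ↔ A.xmax < B.xmin :=
  squeeze_lt_squeeze R.xmin_lt_xmid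

@[simp]
theorem squeezeInto_xmax_lt_xmax :
    (R.squeezeInto A).xmax < (R.squeezeInto B).xmax ↔ A.xmax < B.xmax :=
  squeeze_lt_squeeze R.xmin_lt_xmid

@[simp]
theorem squeezeInto_ymin_lt_ymin :
    (R.squeezeInto A).ymin < (R.squeezeInto B).ymin ↔ A.ymin < B.ymin :=
  squeeze_lt_squeeze R.hy

@[simp]
theorem squeezeInto_ymax_lt_ymin :
    (R.squeezeInto A).ymax < (R.squeezeInto B).ymin ↔ A.ymax < B.ymin :=
  squeeze_lt_squeeze R.hy

@[simp]
theorem squeezeInto_ymax_lt_ymax :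
    (R.squeezeInto A).ymax < (R.squeezeInto B).ymax ↔ A.ymax < B.ymax :=
  squeeze_lt_squeeze R.hy

@[simp]
theorem squeezeInto_enters : (R.squeezeInto A).Enters (R.squeezeInto B) ↔ A.Enters B := by
  simp [Enters]

@[simp]
theorem squeezeInto_within_squeezeInto :
    (R.squeezeInto A).Within (R.squeezeInto B) ↔ A.Within B := by
  simp [Within]

@[simp]
theorem squeezeInto_startsIn : (R.squeezeInto A).StartsIn (R.squeezeInto B) ↔ A.StartsIn B := by
  simp [StartsIn]

@[simp]
theorem squeezeInto_apart : (R.squeezeInto A).Apart (R.squeezeInto B) ↔ A.Apart B := by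
  simp [Apart]

end squeezeInto

/-- `A` does not meet the horizontal strip to the right of the left side of `R`. -/
def Avoids (A R : Frame) : Prop := A.xmax < R.xmin ∨ A.ymax < R.ymin ∨ R.ymax < A.ymin

/-- The ranges of the second coordinate of the two frames are disjoint. -/
def YApart (A B : Frame) : Prop := A.ymax < B.ymin ∨ B.ymax < A.ymin

@[simp]
theorem squeezeInto_avoids {R A B : Frame} :
    (R.squeezeInto A).Avoids (R.squeezeInto B) ↔ A.Avoids B := by
  simp [Avoids]

@[simp]
theorem squeezeInto_yApart {R A B : Frame} :
    (R.squeezeInto A).YApart (R.squeezeInto B) ↔ A.YApart B := by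
  simp [YApart]

theorem Within.yApart {A B A' B' : Frame} (h : A.YApart B) (hA : A'.Within A) (hB : B'.Within B) :
    A'.YApart B' := by
  unfold YApart Within at *
  grind

theorem YApart.symm {A B : Frame} (h : A.YApart B) : B.YApart A := Or.symm h

theorem YApart.apart {A B : Frame} (h : A.YApart B) : A.Apart B := .inr (.inr h)

theorem YApart.avoids {A B : Frame} (h : A.YApart B) : A.Avoids B := .inr h

theorem YApart.not_startsIn {A B : Frame} (h : A.YApart B) : ¬ A.StartsIn B := by
  have := A.hy
  unfold YApart StartsIn at *
  grind

theorem Avoids.apart {A R C : Frame} (h : A.Avoids R) (hC : C.Within R) : A.Apart C := by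
  unfold Avoids Within Apart at *
  grind

theorem Avoids.not_startsIn {A R C : Frame} (h : A.Avoids R) (hC : C.Within R) :
    ¬ C.StartsIn A := by
  have := C.hy
  unfold Avoids Within StartsIn at *
  grind

theorem Avoids.not_startsIn_of_within {A R C : Frame} (h : A.Avoids R) (hC : C.Within R) :
    ¬ A.StartsIn C := by
  have := A.hx
  have := A.hy
  unfold Avoids Within StartsIn at *
  grind

theorem Avoids.within {A R C : Frame} (h : A.Avoids R) (hC : C.Within R) : A.Avoids C := by
  unfold Avoids Within at *
  grind

/-- The three frames added for a pair of stable sets `S`, `Q`: the frame of the new vertex, and the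
roots for `S ∪ Q` and for `S ∪ {v_{S,Q}}`, where `R` is the root of `S`, and `r` is the root of `Q`
in the copy attached to `S`. -/
theorem exists_new (R r : Frame) (hr : r.Within R) (hmid : r.xmax < R.xmid) :
    ∃ N C D : Frame, N.Within R ∧ C.Within R ∧ D.Within R ∧ N.YApart C ∧ C.YApart D ∧
      D.Within N ∧ D.xmin = R.xmid ∧ C.ymin > r.ymin ∧ C.ymax < r.ymax ∧ C.xmin > r.xmin ∧
      C.xmax < r.xmax ∧ r.xmin < N.xmin ∧ N.xmin < r.xmax ∧ R.xmid < N.xmax ∧ r.ymin < N.ymin ∧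
      N.ymax < r.ymax := by
  have hrx := r.hx
  have hry := r.hy
  have h1 := R.xmin_lt_xmid
  have h2 := R.xmid_lt_xmax
  obtain ⟨h3, h4, h5, h6⟩ := hr
  -- In units of `h` above the bottom of `r`, `N` occupies heights 4 to 8, `D` 5 to 7 and `C` 12 to
  -- 16. `N` runs from the middle of `r` past the midline of `R`; `C` stays in `r`; `D` starts on
  -- the midline, beyond everything squeezed into the left half.
  let h := (r.ymax - r.ymin) / 20
  have hh : 0 < h := by simp only [h]; linarith
  have hh' : r.ymax = r.ymin + 20 * h := by simp only [h]; ring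
  refine ⟨⟨(r.xmin + r.xmax) / 2, (R.xmid + R.xmax) / 2, r.ymin + 4 * h, r.ymin + 8 * h,
    by linarith, by linarith⟩,
    ⟨(3 * r.xmin + r.xmax) / 4, (r.xmin + r.xmax) / 2, r.ymin + 12 * h, r.ymin + 16 * h,
    by linarith, by linarith⟩,
    ⟨R.xmid, (3 * R.xmid + R.xmax) / 4, r.ymin + 5 * h, r.ymin + 7 * h,
    by linarith, by linarith⟩, ?_⟩
  simp only [Within, YApart]
  refine ⟨⟨?_, ?_, ?_, ?_⟩, ⟨?_, ?_, ?_, ?_⟩, ⟨?_, ?_, ?_, ?_⟩, .inl ?_, .inr ?_, ⟨?_, ?_, ?_, ?_⟩,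
    trivial, ?_, ?_, ?_, ?_, ?_, ?_, ?_, ?_, ?_⟩ <;> linarith

end Frame

/-! ### Realizing Burling graphs by frames -/

namespace StablePair

variable {P : StablePair}

/-- The frames `f` realize the graph of `P`, and the rectangle bounded by `R S`, together with the
horizontal strip to its right, meets exactly the frames of `S`, which it enters. -/
structure Realizes (P : StablePair) (f : P.V → Frame) (R : P.sets → Frame) : Prop where
  adj : ∀ v w, P.graph.Adj v w → (f v).Enters (f w) ∨ (f w).Enters (f v)
  not_adj : ∀ v w, v ≠ w → ¬ P.graph.Adj v w →
    (f v).Within (f w) ∨ (f w).Within (f v) ∨ (f v).Apart (f w)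
  not_startsIn : ∀ v w x, (f v).Enters (f w) → (f x).StartsIn (f v) → ¬ (f x).StartsIn (f w)
  mem : ∀ S : P.sets, ∀ v ∈ S.1, (R S).Within (f v)
  notMem : ∀ S : P.sets, ∀ v ∉ S.1, (f v).Avoids (R S)
  yApart : ∀ S T, S ≠ T → (R S).YApart (R T)

namespace Realizes

variable {f : P.V → Frame} {R : P.sets → Frame}

theorem isArrangement (h : Realizes P f R) : IsArrangement f where
  generic v w hvw := by
    by_cases hadj : P.graph.Adj v w
    · exact (h.adj v w hadj).elim .inl fun h => .inr (.inl h)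
    · exact .inr (.inr (h.not_adj v w hvw hadj))
  not_startsIn := h.not_startsIn

theorem adj_iff (h : Realizes P f R) {v w : P.V} :
    P.graph.Adj v w ↔ v ≠ w ∧ (f v).Meets (f w) := by
  refine ⟨fun hvw => ⟨hvw.ne, (h.adj v w hvw).elim Enters.meets fun h => h.meets.symm⟩, ?_⟩
  rintro ⟨hne, hm⟩
  by_contra hadj
  rcases h.not_adj v w hne hadj with h | h | h
  · exact h.not_meets hm
  · exact h.not_meets hm.symm
  · exact h.not_meets hm

end Realizes

/-- Combine frames for the three kinds of vertices of `P.next`. -/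
def nextFrames (f : P.V → Frame) (g : P.sets → P.V → Frame) (N : P.sets → P.sets → Frame)
    (v : P.next.V) : Frame :=
  match (v : NextVertex P) with
  | .base u => f u
  | .copy S u => g S u
  | .new S Q => N S Q

section nextFrames

variable {f : P.V → Frame} {g : P.sets → P.V → Frame} {N : P.sets → P.sets → Frame}

@[simp]
theorem nextFrames_base (v : P.V) : nextFrames f g N (base v) = f v := rfl

@[simp]
theorem nextFrames_copy (S : P.sets) (v : P.V) : nextFrames f g N (copy S v) = g S v := rfl

@[simp]
theorem nextFrames_new (S Q : P.sets) : nextFrames f g N (new S Q) = N S Q := rfl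

end nextFrames

/-- Everything new is placed inside old roots. A base frame either contains a root or avoids it, and
different roots have disjoint vertical ranges, so the only interactions to control are those inside
a single root. -/
theorem Realizes.next {f : P.V → Frame} {R : P.sets → Frame} (h : Realizes P f R) :
    ∃ f' R', Realizes P.next f' R' := by
  choose N C D hNR hCR hDR hNC hCD hDN hD hC1 hC2 hC3 hC4 hN1 hN2 hN3 hN4 hN5 using
    fun S Q => exists_new (R S) ((R S).squeezeInto (R Q)) squeezeInto_within squeezeInto_lt_xmid
  have hR' : ∀ X : P.next.sets, ∃ E S Q, X = unionCopy S Q ∧ E = C S Q ∨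
      X = unionNew S Q ∧ E = D S Q := fun X => by
    obtain ⟨S, Q, rfl | rfl⟩ := eq_union X
    exacts [⟨_, S, Q, .inl ⟨rfl, rfl⟩⟩, ⟨_, S, Q, .inr ⟨rfl, rfl⟩⟩]
  choose R' hR' using hR'
  let g : P.sets → P.V → Frame := fun S v => (R S).squeezeInto (f v)
  have hgR : ∀ S v, (g S v).Within (R S) := fun S v => squeezeInto_within
  -- the frames of the base copy against the frames inside a root
  have baseIn : ∀ (S : P.sets) (v : P.V) (A : Frame), v ∈ S.1 → A.Within (R S) → A.Within (f v) := fun S v A hv hA =>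
    hA.trans (h.mem S v hv)
  have baseOut : ∀ (S : P.sets) (v : P.V) (A : Frame), v ∉ S.1 → A.Within (R S) → (f v).Apart A := fun S v A hv hA =>
    (h.notMem S v hv).apart hA
  have base_rel : ∀ (S : P.sets) (v : P.V) (A : Frame), A.Within (R S) → A.Within (f v) ∨ (f v).Apart A := fun S v A hA => by
    by_cases hv : v ∈ S.1
    exacts [.inl (baseIn S v A hv hA), .inr (baseOut S v A hv hA)]
  have base_mem : ∀ (S : P.sets) (v : P.V) (A : Frame), A.Within (R S) → A.StartsIn (f v) → v ∈ S.1 := fun S v A hA h' => by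
    by_contra hv
    exact (h.notMem S v hv).not_startsIn hA h'
  have base_not : ∀ (S : P.sets) (v : P.V) (A : Frame), A.Within (R S) → ¬ (f v).StartsIn A := fun S v A hA h' => by
    by_cases hv : v ∈ S.1
    · exact lt_asymm (baseIn S v A hv hA).1 h'.1
    · exact (h.notMem S v hv).not_startsIn_of_within hA h'
  have rootApart : ∀ (S T : P.sets) (A B : Frame), S ≠ T → A.Within (R S) → B.Within (R T) → A.YApart B :=
    fun S T A B hST hA hB => Within.yApart (h.yApart S T hST) hA hB
  have innerApart : ∀ S Q Q' : P.sets, Q ≠ Q' →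
      ((R S).squeezeInto (R Q)).YApart ((R S).squeezeInto (R Q')) :=
    fun S Q Q' hQ => squeezeInto_yApart.2 (h.yApart Q Q' hQ)
  have copyOut : ∀ (S Q : P.sets) (v : P.V), v ∉ Q.1 → (g S v).Avoids ((R S).squeezeInto (R Q)) :=
    fun S Q v hv => squeezeInto_avoids.2 (h.notMem Q v hv)
  have copyIn : ∀ (S Q : P.sets) (v : P.V), v ∈ Q.1 → ((R S).squeezeInto (R Q)).Within (g S v) :=
    fun S Q v hv => squeezeInto_within_squeezeInto.2 (h.mem Q v hv)
  have gmid : ∀ S v, (g S v).xmax < (R S).xmid := fun S v => squeezeInto_lt_xmid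
  have newIn : ∀ (S Q : P.sets) (v : P.V), v ∈ Q.1 → (N S Q).Enters (g S v) := fun S Q v hv => by
    have h1 := copyIn S Q v hv
    have := gmid S v
    have := hN1 S Q
    have := hN2 S Q
    have := hN3 S Q
    have := hN4 S Q
    have := hN5 S Q
    unfold Within at h1
    unfold Enters
    grind
  have newOut : ∀ (S Q : P.sets) (v : P.V), v ∉ Q.1 → (N S Q).Apart (g S v) := fun S Q v hv => by
    have h1 := copyOut S Q v hv
    have := hN1 S Q
    have := hN4 S Q
    have := hN5 S Q
    unfold Avoids at h1
    unfold Apart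
    grind
  have newApart : ∀ S Q Q' : P.sets, Q ≠ Q' → (N S Q).YApart (N S Q') := fun S Q Q' hQ => by
    have h1 := innerApart S Q Q' hQ
    have := hN4 S Q
    have := hN5 S Q
    have := hN4 S Q'
    have := hN5 S Q'
    unfold YApart at *
    grind
  have adj : ∀ v w, P.next.graph.Adj v w →
      (nextFrames f g N v).Enters (nextFrames f g N w) ∨
        (nextFrames f g N w).Enters (nextFrames f g N v) := by
    intro v w hvw
    rcases next_cases v with ⟨v, rfl⟩ | ⟨S, v, rfl⟩ | ⟨S, Q, rfl⟩ <;>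
    rcases next_cases w with ⟨w, rfl⟩ | ⟨T, w, rfl⟩ | ⟨T, Q', rfl⟩ <;> simp at hvw
    · exact h.adj v w hvw
    · obtain ⟨rfl, hvw⟩ := hvw
      exact (h.adj v w hvw).imp squeezeInto_enters.2 squeezeInto_enters.2
    · obtain ⟨rfl, hvw⟩ := hvw
      exact .inr (newIn _ _ _ hvw)
    · obtain ⟨rfl, hvw⟩ := hvw
      exact .inl (newIn _ _ _ hvw)
  have symm : ∀ {A B : Frame}, A.Within B ∨ B.Within A ∨ A.Apart B →
      B.Within A ∨ A.Within B ∨ B.Apart A := by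
    intro A B h
    unfold Apart at *
    tauto
  have not_adj : ∀ v w, v ≠ w → ¬ P.next.graph.Adj v w →
      (nextFrames f g N v).Within (nextFrames f g N w) ∨
        (nextFrames f g N w).Within (nextFrames f g N v) ∨
          (nextFrames f g N v).Apart (nextFrames f g N w) := by
    have copy_new : ∀ S v T Q, ¬ (T = S ∧ v ∈ Q.1) → (N T Q).Apart (g S v) := by
      intro S v T Q hvw
      by_cases hST : T = S
      · subst hST
        exact newOut _ _ _ fun h => hvw ⟨rfl, h⟩
      · exact (rootApart T S _ _ hST (hNR T Q) (hgR S v)).apart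
    intro v w hne hvw
    rcases next_cases v with ⟨v, rfl⟩ | ⟨S, v, rfl⟩ | ⟨S, Q, rfl⟩ <;>
    rcases next_cases w with ⟨w, rfl⟩ | ⟨T, w, rfl⟩ | ⟨T, Q', rfl⟩ <;> simp at hne hvw ⊢
    · exact h.not_adj v w hne hvw
    · exact .inr (base_rel T v _ (hgR T w))
    · exact .inr (base_rel T v _ (hNR T Q'))
    · exact symm (.inr (base_rel S w _ (hgR S v)))
    · by_cases hST : S = T
      · subst hST
        simpa [g] using h.not_adj v w (hne rfl) (hvw rfl)
      · exact .inr (.inr (rootApart S T _ _ hST (hgR S v) (hgR T w)).apart)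
    · exact symm (.inr (.inr (copy_new S v T Q' fun h => hvw h.1 h.2)))
    · exact symm (.inr (base_rel S w _ (hNR S Q)))
    · exact .inr (.inr (copy_new T w S Q fun h => hvw h.1 h.2))
    · by_cases hST : S = T
      · subst hST
        exact .inr (.inr (newApart S Q Q' (hne rfl)).apart)
      · exact .inr (.inr (rootApart S T _ _ hST (hNR S Q) (hNR T Q')).apart)
  refine ⟨nextFrames f g N, R', adj, not_adj, ?_, ?_, ?_, ?_⟩
  · intro v w x hvw hxv hxw
    have hadj : P.next.graph.Adj v w := by
      by_contra hadj
      have hne : v ≠ w := by rintro rfl; exact lt_irrefl _ hvw.1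
      rcases not_adj v w hne hadj with h | h | h
      · exact h.not_meets hvw.meets
      · exact h.not_meets hvw.meets.symm
      · exact h.not_meets hvw.meets
    -- the left sides in the frames of the copy attached to `S` belong to that copy
    have inner : ∀ S A, A.Within (R S) → (nextFrames f g N x).StartsIn A →
        (∃ u, x = copy S u) ∨ ∃ Q, x = new S Q := by
      intro S A hA hxA
      rcases next_cases x with ⟨u, rfl⟩ | ⟨T, u, rfl⟩ | ⟨T, Q, rfl⟩
      · exact absurd hxA (base_not S u A hA)
      · by_cases hST : T = S
        · subst hST; exact .inl ⟨u, rfl⟩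
        · exact absurd hxA (rootApart T S _ _ hST (hgR T u) hA).not_startsIn
      · by_cases hST : T = S
        · subst hST; exact .inr ⟨Q, rfl⟩
        · exact absurd hxA (rootApart T S _ _ hST (hNR T Q) hA).not_startsIn
    have new_mem : ∀ (S Q : P.sets) (v : P.V), (N S Q).StartsIn (g S v) → v ∈ Q.1 := by
      intro S Q v h'
      by_contra hv
      have h1 := newOut S Q v hv
      have h2 := copyOut S Q v hv
      have := hN1 S Q
      have := (N S Q).hy
      have := hN4 S Q
      have := hN5 S Q
      unfold Avoids at h2
      unfold StartsIn at h'
      grind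
    rcases next_cases v with ⟨v, rfl⟩ | ⟨S, v, rfl⟩ | ⟨S, Q, rfl⟩ <;>
    rcases next_cases w with ⟨w, rfl⟩ | ⟨T, w, rfl⟩ | ⟨T, Q', rfl⟩ <;> simp at hadj hvw hxv hxw
    · rcases next_cases x with ⟨x, rfl⟩ | ⟨S, x, rfl⟩ | ⟨S, Q, rfl⟩
      · exact h.not_startsIn v w x hvw hxv hxw
      -- Base frames around something inside the root of `S` belong to `S`, so they cannot be
      -- adjacent.
      · exact P.stable S.1 S.2 (base_mem S v _ (hgR S x) hxv) (base_mem S w _ (hgR S x) hxw)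
          hadj.ne hadj
      · exact P.stable S.1 S.2 (base_mem S v _ (hNR S Q) hxv) (base_mem S w _ (hNR S Q) hxw)
          hadj.ne hadj
    · obtain ⟨rfl, hadj⟩ := hadj
      rcases inner S _ (hgR S v) hxv with ⟨x, rfl⟩ | ⟨Q, rfl⟩
      · simp only [nextFrames_copy, g, squeezeInto_startsIn, squeezeInto_enters] at hvw hxv hxw
        exact h.not_startsIn v w x hvw hxv hxw
      · exact P.stable Q.1 Q.2 (new_mem S Q v hxv) (new_mem S Q w hxw) hadj.ne hadj
    · obtain ⟨rfl, hadj⟩ := hadj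
      exact lt_asymm hvw.1 (newIn _ _ _ hadj).1
    · obtain ⟨rfl, hadj⟩ := hadj
      -- No left side lies inside `N S Q`: frames of `Q` start before it, other frames of the copy
      -- avoid the strip of the root of `Q`, and other new frames lie at different heights.
      rcases inner S _ (hNR S Q) hxv with ⟨x, rfl⟩ | ⟨Q', rfl⟩
      · simp only [nextFrames_copy] at hxv
        by_cases hx : x ∈ Q.1
        · exact lt_asymm hxv.1 (newIn S Q x hx).1
        · have h1 := newOut S Q x hx
          have h2 := copyOut S Q x hx
          have := (g S x).hx
          have := (g S x).hy
          have := hN1 S Q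
          have := hN4 S Q
          have := hN5 S Q
          unfold Avoids at h2
          unfold StartsIn at hxv
          grind
      · by_cases hQ : Q' = Q
        · subst hQ; exact lt_irrefl _ hxv.1
        · exact (newApart S Q' Q hQ).not_startsIn hxv
  · intro X v hv
    obtain ⟨S, Q, ⟨rfl, hE⟩ | ⟨rfl, hE⟩⟩ := hR' X <;> rw [hE] <;>
    rcases next_cases v with ⟨v, rfl⟩ | ⟨T, v, rfl⟩ | ⟨T, Q', rfl⟩ <;> simp at hv ⊢
    · exact baseIn S v _ hv (hCR S Q)
    · obtain ⟨rfl, hv⟩ := hv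
      exact Within.trans ⟨hC3 S Q, hC4 S Q, hC1 S Q, hC2 S Q⟩ (copyIn S Q v hv)
    · exact baseIn S v _ hv (hDR S Q)
    · obtain ⟨rfl, rfl⟩ := hv
      exact hDN _ _
  · intro X v hv
    obtain ⟨S, Q, ⟨rfl, hE⟩ | ⟨rfl, hE⟩⟩ := hR' X <;> rw [hE] <;>
    rcases next_cases v with ⟨v, rfl⟩ | ⟨T, v, rfl⟩ | ⟨T, Q', rfl⟩ <;> simp at hv ⊢
    · exact (h.notMem S v hv).within (hCR S Q)
    · by_cases hST : S = T
      · subst hST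
        exact (copyOut S Q v (hv rfl)).within ⟨hC3 S Q, hC4 S Q, hC1 S Q, hC2 S Q⟩
      · exact (rootApart S T _ _ hST (hCR S Q) (hgR T v)).symm.avoids
    · by_cases hST : S = T
      · subst hST
        by_cases hQ : Q' = Q
        · subst hQ
          exact (hNC S Q').avoids
        · have h1 := innerApart S Q' Q hQ
          have := hN4 S Q'
          have := hN5 S Q'
          have := hC1 S Q
          have := hC2 S Q
          refine YApart.avoids ?_
          unfold YApart at *
          grind
      · exact (rootApart S T _ _ hST (hCR S Q) (hNR T Q')).symm.avoids
    · exact (h.notMem S v hv).within (hDR S Q)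
    · by_cases hST : S = T
      · subst hST
        -- The root of `S ∪ {v_{S,Q}}` starts at the midline, to the right of the whole copy,
        -- including the frames of `Q`.
        exact .inl ((gmid S v).trans_eq (hD S Q).symm)
      · exact (rootApart S T _ _ hST (hDR S Q) (hgR T v)).symm.avoids
    · by_cases hST : S = T
      · subst hST
        have h1 := newApart S Q' Q (hv rfl)
        have h2 := hDN S Q
        refine YApart.avoids ?_
        unfold YApart Within at *
        grind
      · exact (rootApart S T _ _ hST (hDR S Q) (hNR T Q')).symm.avoids
  · intro X Y hXY
    have inR : ∀ X, ∃ S Q, (R' X).Within (R S) ∧ (X = unionCopy S Q ∧ R' X = C S Q ∨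
        X = unionNew S Q ∧ R' X = D S Q) := fun X => by
      obtain ⟨S, Q, hE⟩ := hR' X
      refine ⟨S, Q, ?_, hE⟩
      rcases hE with ⟨-, hE⟩ | ⟨-, hE⟩ <;> rw [hE]
      exacts [hCR S Q, hDR S Q]
    have inr : ∀ S Q E, E = C S Q ∨ E = D S Q →
        ((R S).squeezeInto (R Q)).ymin < E.ymin ∧ E.ymax < ((R S).squeezeInto (R Q)).ymax := by
      rintro S Q E (rfl | rfl)
      · exact ⟨hC1 S Q, hC2 S Q⟩
      · exact ⟨(hN4 S Q).trans (hDN S Q).2.2.1, (hDN S Q).2.2.2.trans (hN5 S Q)⟩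
    obtain ⟨S, Q, hX, hE⟩ := inR X
    obtain ⟨T, Q', hY, hE'⟩ := inR Y
    by_cases hST : S = T
    · subst hST
      by_cases hQ : Q = Q'
      · subst hQ
        rcases hE with ⟨rfl, hE⟩ | ⟨rfl, hE⟩ <;> rcases hE' with ⟨rfl, hE'⟩ | ⟨rfl, hE'⟩
        · exact absurd rfl hXY
        · rw [hE, hE']; exact hCD S Q
        · rw [hE, hE']; exact (hCD S Q).symm
        · exact absurd rfl hXY
      · have h1 := innerApart S Q Q' hQ
        have h2 := inr S Q _ (hE.imp And.right And.right)
        have h3 := inr S Q' _ (hE'.imp And.right And.right)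
        unfold YApart at *
        grind
    · exact rootApart S T _ _ hST hX hY

end StablePair

theorem exists_realizes_burlingPair (k : ℕ) : ∃ f R, Realizes (burlingPair k) f R := by
  induction k with
  | zero =>
    have hS : ∀ S : (burlingPair 0).sets, S.1 = Set.univ := fun S => S.2
    refine ⟨fun _ => ⟨0, 3, 0, 3, by norm_num, by norm_num⟩,
      fun _ => ⟨1, 2, 1, 2, by norm_num, by norm_num⟩, fun v w h => absurd h id,
      fun v w h => absurd rfl h, fun v w x h => absurd h.1 (lt_irrefl _), fun S v _ => ?_,
      fun S v h => absurd (Set.mem_univ v) (hS S ▸ h), fun S T h => ?_⟩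
    · unfold Within; norm_num
    · exact absurd (Subtype.ext ((hS S).trans (hS T).symm)) h
  | succ k ih =>
    obtain ⟨f, R, h⟩ := ih
    exact h.next

theorem IsBurlingGraph.isStrictFrameGraph {V : Type*} {G : SimpleGraph V}
    (h : IsBurlingGraph G) : IsStrictFrameGraph G := by
  obtain ⟨k, W, ⟨φ⟩⟩ := h
  obtain ⟨f, R, hf⟩ := exists_realizes_burlingPair k
  -- The conditions of an arrangement pass to subfamilies, which handles induced subgraphs.
  have harr : IsArrangement fun w : W => f w :=
    ⟨fun v w h => hf.isArrangement.generic v w fun h' => h (Subtype.ext h'),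
      fun v w x => hf.not_startsIn v w x⟩
  refine ⟨_, harr.isStrict_range, ⟨φ.trans ⟨Equiv.ofInjective _ harr.injective, ?_⟩⟩⟩
  intro v w
  refine Iff.trans (and_congr ?_ Iff.rfl) (hf.adj_iff (v := v.1) (w := w.1)).symm
  rw [Ne, (Equiv.ofInjective _ harr.injective).injective.eq_iff, Ne, Subtype.ext_iff]

/-- A finite graph is a strict frame graph if and only if it is a Burling graph. -/
theorem theorem6p6 {V : Type*} [Finite V] (G : SimpleGraph V) :
    IsStrictFrameGraph G ↔ IsBurlingGraph G :=
  ⟨fun h => h.isBurlingGraph, fun h => h.isStrictFrameGraph⟩
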